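/- **Theorem 6.1 (Polynomial off-diagonal decay).** For $0<\theta\le 1$ let $$f_\theta(x)=\{\theta/x\}-\theta\{1/x\}\quad(0<x\le 1),$$ where $\{\cdot\}$ is the fractional part, and extend $f_\theta$ by $0$ to $(0,\infty)$, so that $f_\theta\in L^2((0,1])\subset L^2((0,\infty))$. For $f\in L^2((0,\infty))$ let $t\mapsto M[f](\tfrac12+it)$ be its ($L^2$, Plancherel) Mellin transform on the critical line, $M[f](s)=\int_0^\infty f(x)x^{s-1}\,dx$. For a smooth even $\psi:\mathbb R\to\mathbb R$ with $0<a\le|\psi|\le A<\infty$ let $T_\psi$ be the bounded operator on $L^2((0,\infty))$ with $$M[T_\psi f](\tfrac12+it)=\psi(t)\,M[f](\tfrac12+it).$$ Let $W>0$, $\epsilon>0$, $\psi_W(t)=\epsilon+e^{-(t/W)^2}$ and $g_\theta=T_{\psi_W}f_\theta$. For $(j,k)\in\mathbb Z_{\ge0}^2$ put $\theta_{j,k}=2^{-j}3^{-k}$, and let $d((j,k),(j',k'))=|j-j'|+|k-k'|$ and $c=\min\{\log 2,\log 3\}$. Let $X$ be $(0,\infty)$ or $(0,1]$, and write $\langle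 g,h\rangle=\int_X g(x)\overline{h(x)}\,dx$. Then: 1. For every integer $m\ge1$ there is a constant $C_m(W)>0$ (which may also depend on the fixed $\epsilon$) such that for all distinct ladder indices $(j,k)\ne(j',k')$ $$|\langle g_{\theta_{j,k}},g_{\theta_{j',k'}}\rangle|\le\frac{C_m(W)}{(1+c\,d((j,k),(j',k')))^m}.$$ 2. Every row of the Gram matrix is $\ell^1$-summable off the diagonal: $\sum_{(j',k')\ne(j,k)}|\langle g_{\theta_{j,k}},g_{\theta_{j',k'}}\rangle|<\infty$ for every $(j,k)$. Moreover the matrix is block-compressible: for every integer $m>2$ there is a constant $K_m(W)>0$ (which may also depend on $\epsilon$), independent of $(j,k)$ and $B$, such that for all $(j,k)$ and all integers $B\ge1$ $$\sum_{d((j,k),(j',k'))\ge B}|\langle g_{\theta_{j,k}},g_{\theta_{j',k'}}\rangle|\le\frac{K_m(W)}{(1+B)^{m-2}}.$$ -/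

import Mathlib

open MeasureTheory Set
open scoped ENNReal FourierTransform ContDiff ComplexConjugate

noncomputable section

namespace BeurlingNyman

/-- Complex `L²` on the half-line `(0, ∞)` with Lebesgue measure. The space `L²((0, 1])` is regarded
as a subspace of it, through extension by zero. -/
abbrev L2Half : Type := Lp ℂ 2 ((volume : Measure ℝ).restrict (Ioi 0))

/-- Complex `L²` on the real line with Lebesgue measure. -/
abbrev L2Line : Type := Lp ℂ 2 (volume : Measure ℝ)

/-! ### The Mellin transform on the critical line as a unitary map -/

theorem image_exp_neg : (fun u : ℝ => Real.exp (-u)) '' univ = Ioi 0 := by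
  ext x
  constructor
  · rintro ⟨u, -, rfl⟩
    exact Real.exp_pos _
  · intro hx
    exact ⟨-Real.log x, mem_univ _, by simp [Real.exp_log (mem_Ioi.1 hx)]⟩

theorem lintegral_half (F : ℝ → ℝ≥0∞) :
    ∫⁻ x in Ioi 0, F x = ∫⁻ u : ℝ, ENNReal.ofReal (Real.exp (-u)) * F (Real.exp (-u)) := by
  rw [← image_exp_neg, lintegral_image_eq_lintegral_abs_deriv_mul MeasurableSet.univ
    (f' := fun u => -Real.exp (-u))]
  · simp
  · intro u _
    have h := (hasDerivAt_neg u).exp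
    rw [mul_neg_one] at h
    exact h.hasDerivWithinAt
  · intro a _ b _ h
    simpa using h

theorem qmp_exp_neg : Measure.QuasiMeasurePreserving (fun u : ℝ => Real.exp (-u))
    volume ((volume : Measure ℝ).restrict (Ioi 0)) := by
  refine ⟨by fun_prop, Measure.AbsolutelyContinuous.mk fun s hs h => ?_⟩
  rw [Measure.map_apply (by fun_prop) hs]
  have h1 := lintegral_half (s.indicator 1)
  rw [lintegral_indicator_one hs, h, eq_comm, lintegral_eq_zero_iff] at h1
  · have h2 : ∀ᵐ u : ℝ, ¬ (u ∈ (fun u : ℝ => Real.exp (-u)) ⁻¹' s) := by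
      filter_upwards [h1] with u hu hus
      have hus' : Real.exp (-u) ∈ s := hus
      rw [indicator_of_mem hus'] at hu
      simp only [Pi.one_apply, mul_one, Pi.zero_apply, ENNReal.ofReal_eq_zero] at hu
      exact absurd hu (not_le.2 (Real.exp_pos _))
    rw [ae_iff] at h2
    simp only [not_not] at h2
    exact h2
  · exact (by fun_prop : Measurable fun u : ℝ => ENNReal.ofReal (Real.exp (-u))).mul
      ((measurable_one.indicator hs).comp (by fun_prop))

theorem qmp_neg_log : Measure.QuasiMeasurePreserving (fun x : ℝ => -Real.log x)
    ((volume : Measure ℝ).restrict (Ioi 0)) volume := by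
  refine ⟨by fun_prop, Measure.AbsolutelyContinuous.mk fun s hs h => ?_⟩
  have hm : Measurable fun x : ℝ => -Real.log x := by fun_prop
  rw [Measure.map_apply hm hs, ← lintegral_indicator_one (hm hs), lintegral_half]
  rw [lintegral_eq_zero_iff]
  · have h2 : ∀ᵐ u : ℝ, u ∉ s := by simpa [ae_iff] using h
    filter_upwards [h2] with u hu
    simp [hu]
  · exact (by fun_prop : Measurable fun u : ℝ => ENNReal.ofReal (Real.exp (-u))).mul
      ((measurable_one.indicator (hm hs)).comp (by fun_prop))

/-- The function `u ↦ e^{-u/2} f(e^{-u})`: logarithmic coordinates on the half-line. -/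
def toLog (f : ℝ → ℂ) (u : ℝ) : ℂ := (Real.exp (-(1 / 2) * u) : ℂ) * f (Real.exp (-u))

/-- The inverse change of variables, `x ↦ x^{-1/2} h(-log x)`. -/
def ofLog (h : ℝ → ℂ) (x : ℝ) : ℂ := (Real.exp (-(1 / 2) * Real.log x) : ℂ) * h (-Real.log x)

theorem toLog_ofLog (h : ℝ → ℂ) (u : ℝ) : toLog (ofLog h) u = h u := by
  simp only [toLog, ofLog, Real.log_exp, neg_neg, ← mul_assoc]
  rw [← Complex.ofReal_mul, ← Real.exp_add]
  simp

theorem ofLog_toLog (f : ℝ → ℂ) {x : ℝ} (hx : 0 < x) : ofLog (toLog f) x = f x := by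
  simp only [toLog, ofLog, neg_neg, Real.exp_log hx, ← mul_assoc]
  rw [← Complex.ofReal_mul, ← Real.exp_add]
  simp

theorem eLpNorm_toLog (f : ℝ → ℂ) :
    eLpNorm (toLog f) 2 volume = eLpNorm f 2 ((volume : Measure ℝ).restrict (Ioi 0)) := by
  rw [eLpNorm_eq_lintegral_rpow_enorm_toReal (by norm_num) (by norm_num),
    eLpNorm_eq_lintegral_rpow_enorm_toReal (by norm_num) (by norm_num), lintegral_half]
  congr 2
  funext u
  have h1 : ‖(Real.exp (-(1 / 2) * u) : ℂ)‖ₑ ^ (2 : ℝ) = ENNReal.ofReal (Real.exp (-u)) := by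
    rw [← ofReal_norm, Complex.norm_real, Real.norm_of_nonneg (Real.exp_pos _).le,
      ENNReal.ofReal_rpow_of_pos (Real.exp_pos _), ← Real.exp_mul]
    congr 2
    ring
  simp only [toLog, enorm_mul, ENNReal.toReal_ofNat]
  rw [ENNReal.mul_rpow_of_nonneg _ _ (by norm_num), h1]

theorem memLp_toLog {f : ℝ → ℂ} (hf : MemLp f 2 ((volume : Measure ℝ).restrict (Ioi 0))) :
    MemLp (toLog f) 2 volume := by
  refine ⟨?_, by rw [eLpNorm_toLog]; exact hf.2⟩
  exact (by fun_prop : Continuous fun u : ℝ =>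
    (Real.exp (-(1 / 2) * u) : ℂ)).aestronglyMeasurable.mul
    (hf.1.comp_quasiMeasurePreserving qmp_exp_neg)

theorem memLp_ofLog {h : ℝ → ℂ} (hh : MemLp h 2 volume) :
    MemLp (ofLog h) 2 ((volume : Measure ℝ).restrict (Ioi 0)) := by
  refine ⟨?_, ?_⟩
  · exact (by fun_prop : Measurable fun x : ℝ =>
      (Real.exp (-(1 / 2) * Real.log x) : ℂ)).aestronglyMeasurable.mul
      (hh.1.comp_quasiMeasurePreserving qmp_neg_log)
  · rw [← eLpNorm_toLog, funext (toLog_ofLog h)]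
    exact hh.2

/-- The unitary change of variables `L²(0, ∞) ≃ L²(ℝ)`, `f ↦ (u ↦ e^{-u/2} f(e^{-u}))`. -/
def logIsometry : L2Half ≃ₗᵢ[ℂ] L2Line where
  toFun f := (memLp_toLog (Lp.memLp f)).toLp (toLog f)
  invFun h := (memLp_ofLog (Lp.memLp h)).toLp (ofLog h)
  map_add' f g := by
    rw [← MemLp.toLp_add]
    refine MemLp.toLp_congr _ _ ?_
    filter_upwards [qmp_exp_neg.ae_eq_comp (Lp.coeFn_add f g)] with u hu
    simp only [Function.comp_apply, Pi.add_apply] at hu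
    simp only [toLog, hu, mul_add, Pi.add_apply]
  map_smul' c f := by
    rw [RingHom.id_apply, ← MemLp.toLp_const_smul]
    refine MemLp.toLp_congr _ _ ?_
    filter_upwards [qmp_exp_neg.ae_eq_comp (Lp.coeFn_smul c f)] with u hu
    simp only [Function.comp_apply, Pi.smul_apply, smul_eq_mul] at hu
    simp only [toLog, hu, mul_left_comm, Pi.smul_apply, smul_eq_mul]
  left_inv f := by
    refine Lp.ext ((MemLp.coeFn_toLp _).trans ?_)
    filter_upwards [qmp_neg_log.ae_eq_comp (MemLp.coeFn_toLp (memLp_toLog (Lp.memLp f))),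
      ae_restrict_mem measurableSet_Ioi] with x hx hx0
    simp only [Function.comp_apply] at hx
    rw [ofLog, hx]
    exact ofLog_toLog f (mem_Ioi.1 hx0)
  right_inv h := by
    refine Lp.ext ((MemLp.coeFn_toLp _).trans ?_)
    filter_upwards [qmp_exp_neg.ae_eq_comp (MemLp.coeFn_toLp (memLp_ofLog (Lp.memLp h)))]
      with u hu
    simp only [Function.comp_apply] at hu
    rw [toLog, hu]
    exact toLog_ofLog h u
  norm_map' f := by
    change ‖(memLp_toLog (Lp.memLp f)).toLp (toLog f)‖ = ‖f‖
    rw [Lp.norm_toLp, eLpNorm_toLog, Lp.norm_def]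

/-- The `L²` (Plancherel) Mellin transform on the critical line: the isometric isomorphism
`L²(0, ∞) ≃ L²(ℝ)` that takes `f` to `ξ ↦ M[f](1/2 + 2πiξ)`, where
`M[f](s) = ∫₀^∞ f(x) x^{s-1} dx`. -/
def mellinL2 : L2Half ≃ₗᵢ[ℂ] L2Line :=
  logIsometry.trans (Lp.fourierTransformₗᵢ ℝ ℂ)

theorem integrable_toLog {f : ℝ → ℂ} (hf : MellinConvergent f (1 / 2)) :
    Integrable (toLog f) := by
  have h : IntegrableOn (fun x : ℝ => (x : ℂ) ^ ((1 / 2 : ℂ) - 1) • f x)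
      ((fun u : ℝ => Real.exp (-u)) '' univ) := by
    rw [image_exp_neg]
    exact hf
  rw [integrableOn_image_iff_integrableOn_abs_deriv_smul MeasurableSet.univ
    (f' := fun u => -Real.exp (-u)) (fun u _ => by
      have h := (hasDerivAt_neg u).exp
      rw [mul_neg_one] at h
      exact h.hasDerivWithinAt) (fun a _ b _ h => by simpa using h), integrableOn_univ] at h
  refine h.congr (.of_forall fun u => ?_)
  have h1 : (Real.exp (-u) : ℂ) ^ ((1 / 2 : ℂ) - 1) = (Real.exp (1 / 2 * u) : ℂ) := by
    rw [Complex.ofReal_exp, Complex.cpow_def_of_ne_zero (Complex.exp_ne_zero _),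
      ← Complex.ofReal_exp, ← Complex.ofReal_log (Real.exp_pos _).le, Real.log_exp]
    push_cast
    ring_nf
  simp only [toLog, abs_neg, abs_of_pos (Real.exp_pos _)]
  rw [h1, smul_eq_mul, Complex.real_smul, ← mul_assoc, ← Complex.ofReal_mul, ← Real.exp_add]
  ring_nf

theorem fourier_L2_ae_eq (F : L2Line) (hF : Integrable F) :
    Lp.fourierTransformₗᵢ ℝ ℂ F =ᵐ[volume] 𝓕 (F : ℝ → ℂ) := by
  refine ae_eq_of_integral_contDiff_smul_eq
    ((Lp.memLp (Lp.fourierTransformₗᵢ ℝ ℂ F)).locallyIntegrable (by norm_num))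
    (Continuous.locallyIntegrable ?_) ?_
  · exact VectorFourier.fourierIntegral_continuous Real.continuous_fourierChar
      (L := innerₗ ℝ) continuous_inner hF
  · intro g g_smooth g_cpt
    have hg₁ : HasCompactSupport (Complex.ofRealCLM ∘ g) := g_cpt.comp_left rfl
    have hg₂ : ContDiff ℝ ∞ (Complex.ofRealCLM ∘ g) := by fun_prop
    have h1 := congrArg (fun T => T (hg₁.toSchwartzMap hg₂))
      (Lp.fourier_toTemperedDistribution_eq F)
    simp only [TemperedDistribution.fourier_apply, Lp.toTemperedDistribution_apply] at h1
    have h2 := VectorFourier.integral_fourierIntegral_smul_eq_flip (L := innerₗ ℝ)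
      Real.continuous_fourierChar continuous_inner
      (hg₁.toSchwartzMap hg₂).integrable (μ := volume) (ν := volume) hF
    rw [flip_innerₗ] at h2
    have h3 : ∫ x, (hg₁.toSchwartzMap hg₂) x • (Lp.fourierTransformₗᵢ ℝ ℂ F) x =
        ∫ x, (hg₁.toSchwartzMap hg₂) x • 𝓕 (F : ℝ → ℂ) x := by
      refine h1.symm.trans (Eq.trans ?_ h2)
      rw [SchwartzMap.fourier_coe]
      rfl
    simpa using h3

/-- Where the Mellin integral converges absolutely on the critical line, `mellinL2` is given by it:
`mellinL2` is the usual Mellin transform there. -/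
theorem mellinL2_ae_eq (f : L2Half) (hf : MellinConvergent f (1 / 2)) :
    mellinL2 f =ᵐ[volume] fun ξ : ℝ => mellin f (1 / 2 + 2 * Real.pi * ξ * Complex.I) := by
  have h0 : logIsometry f =ᵐ[volume] toLog f := MemLp.coeFn_toLp (memLp_toLog (Lp.memLp f))
  have h1 : Integrable (logIsometry f) := (integrable_toLog hf).congr h0.symm
  refine (fourier_L2_ae_eq (logIsometry f) h1).trans (.of_forall fun ξ => ?_)
  beta_reduce
  rw [mellin_eq_fourier]
  have hre : ((1 / 2 : ℂ) + 2 * Real.pi * ξ * Complex.I).re = 1 / 2 := by simp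
  have him : ((1 / 2 : ℂ) + 2 * Real.pi * ξ * Complex.I).im / (2 * Real.pi) = ξ := by
    simp [field]
  rw [hre, him, Real.fourier_eq, Real.fourier_eq]
  refine integral_congr_ae ?_
  filter_upwards [h0] with u hu
  rw [hu, toLog, Complex.real_smul]

/-! ### Mellin multipliers -/

/-- An admissible multiplier: a smooth even function `ψ : ℝ → ℝ` with `0 < c ≤ |ψ| ≤ C < ∞`. -/
structure MellinCutoff where
  toFun : ℝ → ℝ
  smooth : ContDiff ℝ ∞ toFun
  even : ∀ t, toFun (-t) = toFun t
  bounded_below : ∃ c : ℝ, 0 < c ∧ ∀ t, c ≤ |toFun t|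
  bounded_above : ∃ C : ℝ, ∀ t, |toFun t| ≤ C

theorem MellinCutoff.memLp_top (ψ : MellinCutoff) :
    MemLp (fun ξ : ℝ => (ψ.toFun (2 * Real.pi * ξ) : ℂ)) ∞ volume := by
  obtain ⟨C, hC⟩ := ψ.bounded_above
  have h := ψ.smooth.continuous
  refine memLp_top_of_bound (by fun_prop : Continuous fun ξ : ℝ =>
    (ψ.toFun (2 * Real.pi * ξ) : ℂ)).aestronglyMeasurable C (.of_forall fun ξ => ?_)
  simpa using hC (2 * Real.pi * ξ)

/-- Multiplication by `ξ ↦ ψ(2πξ)` on `L²(ℝ)`. -/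
def MellinCutoff.mulCLM (ψ : MellinCutoff) : L2Line →L[ℂ] L2Line :=
  (ContinuousLinearMap.mul ℂ ℂ).holderL volume ∞ 2 2 (ψ.memLp_top.toLp _)

/-- The Mellin smoothing operator `T_ψ`, defined by `M[T_ψ f](1/2 + it) = ψ(t) M[f](1/2 + it)`. -/
def smoothing (ψ : MellinCutoff) : L2Half →L[ℂ] L2Half :=
  (mellinL2.symm.toContinuousLinearEquiv : L2Line →L[ℂ] L2Half) ∘L ψ.mulCLM ∘L
    (mellinL2.toContinuousLinearEquiv : L2Half →L[ℂ] L2Line)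

/-- The defining property of `T_ψ`, at `t = 2πξ`. -/
theorem mellinL2_smoothing (ψ : MellinCutoff) (f : L2Half) :
    mellinL2 (smoothing ψ f) =ᵐ[volume]
      fun ξ : ℝ => (ψ.toFun (2 * Real.pi * ξ) : ℂ) * mellinL2 f ξ := by
  have h : mellinL2 (smoothing ψ f) = ψ.mulCLM (mellinL2 f) := by
    simp [smoothing]
  rw [h]
  refine (ContinuousLinearMap.coeFn_holder (r := 2) (ContinuousLinearMap.mul ℂ ℂ)
    (ψ.memLp_top.toLp _) (mellinL2 f)).trans ?_
  filter_upwards [ψ.memLp_top.coeFn_toLp] with ξ hξ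
  simp [hξ]

/-- The Gaussian-type multiplier `ψ_W(t) = ε + e^{-(t/W)²}`. -/
def gaussianCutoff (W ε : ℝ) (hε : 0 < ε) : MellinCutoff where
  toFun t := ε + Real.exp (-(t / W) ^ 2)
  smooth := by fun_prop
  even t := by rw [neg_div, neg_sq]
  bounded_below := by
    refine ⟨ε, hε, fun t => ?_⟩
    have h := Real.exp_pos (-(t / W) ^ 2)
    exact le_trans (by linarith) (le_abs_self _)
  bounded_above := by
    refine ⟨ε + 1, fun t => ?_⟩
    have h := Real.exp_pos (-(t / W) ^ 2)
    have h1 : Real.exp (-(t / W) ^ 2) ≤ 1 := Real.exp_le_one_iff.2 (by nlinarith [sq_nonneg (t / W)])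
    rw [abs_of_pos (by linarith)]
    linarith

/-! ### The Beurling–Nyman functions on the ladder -/

/-- `f_θ(x) = {θ/x} - θ {1/x}` for `x ∈ (0, 1]`, extended by zero. -/
def bnFun (θ : ℝ) : ℝ → ℂ :=
  (Ioc 0 1).indicator fun x => ((Int.fract (θ / x) - θ * Int.fract (1 / x) : ℝ) : ℂ)

theorem memLp_bnFun (θ : ℝ) : MemLp (bnFun θ) 2 ((volume : Measure ℝ).restrict (Ioi 0)) := by
  have hm : Measurable fun x : ℝ => ((Int.fract (θ / x) - θ * Int.fract (1 / x) : ℝ) : ℂ) := by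
    have h1 : Measurable fun x : ℝ => Int.fract (θ / x) :=
      measurable_fract.comp (measurable_const.div measurable_id)
    have h2 : Measurable fun x : ℝ => Int.fract (1 / x) :=
      measurable_fract.comp (measurable_const.div measurable_id)
    exact Complex.measurable_ofReal.comp (h1.sub (h2.const_mul θ))
  rw [bnFun, memLp_indicator_iff_restrict measurableSet_Ioc]
  rw [Measure.restrict_restrict measurableSet_Ioc]
  have : IsFiniteMeasure ((volume : Measure ℝ).restrict (Ioc 0 1 ∩ Ioi 0)) :=
    ⟨by
      rw [Measure.restrict_apply_univ]
      exact (measure_mono inter_subset_left).trans_lt (by simp)⟩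
  refine MemLp.of_bound hm.aestronglyMeasurable (1 + |θ|) (.of_forall fun x => ?_)
  rw [Complex.norm_real, Real.norm_eq_abs]
  have h1 : |Int.fract (θ / x)| ≤ 1 := by
    rw [abs_of_nonneg (Int.fract_nonneg _)]; exact (Int.fract_lt_one _).le
  have h2 : |Int.fract (1 / x)| ≤ 1 := by
    rw [abs_of_nonneg (Int.fract_nonneg _)]; exact (Int.fract_lt_one _).le
  calc _ ≤ |Int.fract (θ / x)| + |θ * Int.fract (1 / x)| := abs_sub _ _
    _ ≤ 1 + |θ| := by
      rw [abs_mul]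
      exact add_le_add h1 (mul_le_of_le_one_right (abs_nonneg _) h2)

/-- `f_θ` as an element of `L²`. -/
def bn (θ : ℝ) : L2Half := (memLp_bnFun θ).toLp _

/-- The ladder parameters `θ_{j,k} = 2^{-j} 3^{-k}`. -/
def ladder (p : ℕ × ℕ) : ℝ := 1 / (2 ^ p.1 * 3 ^ p.2)

/-- The Manhattan distance `|j - j'| + |k - k'|` of two ladder indices. -/
def ladderDist (p q : ℕ × ℕ) : ℕ :=
  ((p.1 : ℤ) - q.1).natAbs + ((p.2 : ℤ) - q.2).natAbs

/-- The entry `∫_X g_{θ_p} (g_{θ_q})^*` of the Gram matrix of the smoothed functions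
`g_θ = T_{ψ_W} f_θ`, for the inner product of `L²(X)`, `X ⊆ (0, ∞)`. -/
def gram (X : Set ℝ) (W ε : ℝ) (hε : 0 < ε) (p q : ℕ × ℕ) : ℂ :=
  ∫ x in X, smoothing (gaussianCutoff W ε hε) (bn (ladder p)) x *
    conj (smoothing (gaussianCutoff W ε hε) (bn (ladder q)) x)

end BeurlingNyman

end

open BeurlingNyman

/-!
The decay needs no oscillation. `‖f_θ‖² ≤ 2θ`: on `(0, θ]` the function `f_θ` is a difference of two
numbers of `[0, 1]`, and for `x > θ` one has `{θ/x} = θ/x`, so that `f_θ(x) = θ⌊1/x⌋ ∈ [0, θ/x]`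
(`norm_bn_sq_le`). The operator `T_ψ` is bounded and restricting the integral from `(0, ∞)` to `X`
only helps, so by Cauchy–Schwarz the Gram entry at `(p, q)` is `O(√(θ_p θ_q))`
(`norm_gram_le_sqrt`).

Since `θ_{j,k} ≤ 2^{-(j+k)}`, with `t = 2^{-1/4}` this is `O(t^{2(j+k+j'+k')})`. As
`d((j,k),(j',k')) ≤ j+k+j'+k'`, the entry is `O(t^d t^{j'+k'})` (`exists_norm_gram_le`): the factor
`t^d` decays faster than any power of `d`, and `∑ t^{j'+k'}` is a product of two geometric series
that does not depend on `(j,k)`.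
-/

namespace BeurlingNyman

/-! ### The norm of `f_θ` -/

theorem norm_bnFun_le_one {θ : ℝ} (h0 : 0 < θ) (h1 : θ ≤ 1) (x : ℝ) : ‖bnFun θ x‖ ≤ 1 := by
  by_cases hx : x ∈ Ioc (0 : ℝ) 1
  · rw [bnFun, indicator_of_mem hx, Complex.norm_real, Real.norm_eq_abs, abs_le]
    have a1 := Int.fract_nonneg (θ / x)
    have a2 := (Int.fract_lt_one (θ / x)).le
    have b1 := Int.fract_nonneg (1 / x)
    have b2 := (Int.fract_lt_one (1 / x)).le
    have b3 : θ * Int.fract (1 / x) ≤ 1 := mul_le_one₀ h1 b1 b2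
    have b4 : 0 ≤ θ * Int.fract (1 / x) := mul_nonneg h0.le b1
    constructor <;> linarith
  · simp [bnFun, indicator_of_notMem hx]

theorem norm_bnFun_le_div {θ x : ℝ} (h0 : 0 < θ) (hx : θ < x) : ‖bnFun θ x‖ ≤ θ / x := by
  have hx0 : 0 < x := h0.trans hx
  have hq : 0 ≤ θ / x := by positivity
  by_cases hx1 : x ∈ Ioc (0 : ℝ) 1
  · rw [bnFun, indicator_of_mem hx1, Complex.norm_real, Real.norm_eq_abs,
      Int.fract_eq_self.2 ⟨hq, (div_lt_one hx0).2 hx⟩]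
    have b1 := mul_nonneg h0.le (Int.fract_nonneg (1 / x))
    have b2 : θ * Int.fract (1 / x) ≤ θ * (1 / x) :=
      mul_le_mul_of_nonneg_left
        (by have := Int.floor_nonneg.2 (by positivity : 0 ≤ 1 / x)
            have h : (0 : ℝ) ≤ ⌊1 / x⌋ := by exact_mod_cast this
            rw [Int.fract]; linarith) h0.le
    rw [mul_one_div] at b2
    rw [abs_le]
    constructor <;> linarith
  · simpa [bnFun, indicator_of_notMem hx1] using hq

theorem norm_bn_sq_le {θ : ℝ} (h0 : 0 < θ) (h1 : θ ≤ 1) : ‖bn θ‖ ^ 2 ≤ 2 * θ := by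
  have hint : IntegrableOn (fun x => ‖bnFun θ x‖ ^ 2) (Ioi 0) :=
    (memLp_bnFun θ).integrable_norm_pow (by norm_num)
  have hnorm : ‖bn θ‖ ^ 2 = ∫ x in Ioi 0, ‖bnFun θ x‖ ^ 2 := by
    have h := (memLp_bnFun θ).eLpNorm_eq_integral_rpow_norm (by norm_num) (by norm_num)
    have hnn : 0 ≤ ∫ x in Ioi 0, ‖bnFun θ x‖ ^ 2 := integral_nonneg fun x => by positivity
    simp only [ENNReal.toReal_ofNat, Real.rpow_ofNat] at h
    rw [bn, Lp.norm_toLp, h, ENNReal.toReal_ofReal (by positivity), ← Real.rpow_natCast,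
      ← Real.rpow_mul hnn]
    norm_num
  have hnear : ∫ x in Ioc 0 θ, ‖bnFun θ x‖ ^ 2 ≤ θ := by
    calc ∫ x in Ioc 0 θ, ‖bnFun θ x‖ ^ 2 ≤ ∫ _ in Ioc 0 θ, (1 : ℝ) :=
          setIntegral_mono (hint.mono_set Ioc_subset_Ioi_self) (by simp)
            fun x => pow_le_one₀ (norm_nonneg _) (norm_bnFun_le_one h0 h1 x)
      _ = θ := by simp [h0.le]
  have hfar : ∫ x in Ioi θ, ‖bnFun θ x‖ ^ 2 ≤ θ := by
    calc ∫ x in Ioi θ, ‖bnFun θ x‖ ^ 2 ≤ ∫ x in Ioi θ, θ ^ 2 * x ^ (-2 : ℝ) := by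
          refine setIntegral_mono_on (hint.mono_set (Ioi_subset_Ioi h0.le))
            ((integrableOn_Ioi_rpow_of_lt (by norm_num) h0).const_mul _) measurableSet_Ioi
            fun x hx => ?_
          have hx0 : 0 < x := h0.trans hx
          calc ‖bnFun θ x‖ ^ 2 ≤ (θ / x) ^ 2 :=
                pow_le_pow_left₀ (norm_nonneg _) (norm_bnFun_le_div h0 hx) 2
            _ = θ ^ 2 * x ^ (-2 : ℝ) := by
                rw [Real.rpow_neg hx0.le, Real.rpow_two, div_pow, div_eq_mul_inv]
      _ = θ := by
          rw [integral_const_mul, integral_Ioi_rpow_of_lt (by norm_num) h0]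
          norm_num
          rw [Real.rpow_neg_one]
          field_simp
  rw [hnorm, ← Ioc_union_Ioi_eq_Ioi h0.le, setIntegral_union (Ioc_disjoint_Ioi le_rfl)
    measurableSet_Ioi (hint.mono_set Ioc_subset_Ioi_self)
    (hint.mono_set (Ioi_subset_Ioi h0.le))]
  linarith

/-! ### Bounds for the Gram entries -/

/-- Cauchy–Schwarz for an inner product over a subset of the half-line. -/
theorem norm_setIntegral_mul_conj_le {X : Set ℝ} (hX : X ⊆ Ioi 0) (g h : L2Half) :
    ‖∫ x in X, g x * conj (h x)‖ ≤ ‖g‖ * ‖h‖ := by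
  have hh : eLpNorm (fun x => conj (h x)) 2 ((volume : Measure ℝ).restrict (Ioi 0)) =
      eLpNorm h 2 ((volume : Measure ℝ).restrict (Ioi 0)) :=
    eLpNorm_congr_norm_ae (.of_forall fun x => by simp)
  have hhm : AEStronglyMeasurable (fun x => conj (h x))
      ((volume : Measure ℝ).restrict (Ioi 0)) :=
    Complex.continuous_conj.comp_aestronglyMeasurable (Lp.aestronglyMeasurable h)
  have key : ‖∫ x in X, g x * conj (h x)‖ₑ ≤ ‖g‖ₑ * ‖h‖ₑ := by
    calc ‖∫ x in X, g x * conj (h x)‖ₑ ≤ ∫⁻ x in X, ‖g x * conj (h x)‖ₑ :=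
          enorm_integral_le_lintegral_enorm _
      _ ≤ ∫⁻ x in Ioi 0, ‖g x * conj (h x)‖ₑ := lintegral_mono_set hX
      _ = eLpNorm ((g : ℝ → ℂ) • fun x => conj (h x)) 1
            ((volume : Measure ℝ).restrict (Ioi 0)) := by
          rw [eLpNorm_one_eq_lintegral_enorm]; rfl
      _ ≤ _ := eLpNorm_smul_le_mul_eLpNorm (p := 2) (q := 2) hhm (Lp.aestronglyMeasurable g)
      _ = ‖g‖ₑ * ‖h‖ₑ := by rw [hh, Lp.enorm_def, Lp.enorm_def]
  simpa [toReal_enorm] using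
    ENNReal.toReal_mono (ENNReal.mul_ne_top enorm_ne_top enorm_ne_top) key

theorem ladder_pos (p : ℕ × ℕ) : 0 < ladder p := by
  unfold ladder; positivity

theorem ladder_le_pow (p : ℕ × ℕ) : ladder p ≤ (1 / 2) ^ (p.1 + p.2) := by
  rw [ladder, div_pow, one_pow, pow_add]
  gcongr
  norm_num

theorem norm_gram_le_sqrt {X : Set ℝ} (hX : X ⊆ Ioi 0) (W ε : ℝ) (hε : 0 < ε) (p q : ℕ × ℕ) :
    ‖gram X W ε hε p q‖ ≤
      2 * ‖smoothing (gaussianCutoff W ε hε)‖ ^ 2 * (√(ladder p) * √(ladder q)) := by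
  set T := smoothing (gaussianCutoff W ε hε)
  have hbn (r : ℕ × ℕ) : ‖T (bn (ladder r))‖ ≤ ‖T‖ * (√2 * √(ladder r)) := by
    refine (T.le_opNorm _).trans (mul_le_mul_of_nonneg_left ?_ (norm_nonneg _))
    rw [← Real.sqrt_mul (by norm_num)]
    exact Real.le_sqrt_of_sq_le (norm_bn_sq_le (ladder_pos r)
      ((ladder_le_pow r).trans (pow_le_one₀ (by norm_num) (by norm_num))))
  calc ‖gram X W ε hε p q‖ ≤ ‖T (bn (ladder p))‖ * ‖T (bn (ladder q))‖ :=
        norm_setIntegral_mul_conj_le hX _ _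
    _ ≤ (‖T‖ * (√2 * √(ladder p))) * (‖T‖ * (√2 * √(ladder q))) :=
        mul_le_mul (hbn p) (hbn q) (norm_nonneg _) (by positivity)
    _ = √2 ^ 2 * ‖T‖ ^ 2 * (√(ladder p) * √(ladder q)) := by ring
    _ = _ := by rw [Real.sq_sqrt (by norm_num)]

theorem ladderDist_le (p q : ℕ × ℕ) : ladderDist p q ≤ (p.1 + p.2) + (q.1 + q.2) := by
  unfold ladderDist; omega

/-- The exponential decay behind both parts of the theorem. The second factor leaves a part of the
decay for summing over `q`, uniformly in `p`. -/
theorem exists_norm_gram_le {X : Set ℝ} (hX : X ⊆ Ioi 0) (W ε : ℝ) (hε : 0 < ε) :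
    ∃ t M : ℝ, 0 < t ∧ t < 1 ∧ 0 < M ∧ ∀ p q : ℕ × ℕ,
      ‖gram X W ε hε p q‖ ≤ M * t ^ ladderDist p q * t ^ (q.1 + q.2) := by
  set T := smoothing (gaussianCutoff W ε hε)
  obtain ⟨t, ht0, ht4⟩ : ∃ t : ℝ, 0 < t ∧ t ^ 4 = 1 / 2 :=
    ⟨√√(1 / 2), by positivity, by
      rw [show 4 = 2 * 2 from rfl, pow_mul, Real.sq_sqrt (by positivity),
        Real.sq_sqrt (by norm_num)]⟩
  have ht1 : t < 1 := by
    by_contra! h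
    have := one_le_pow₀ h (n := 4)
    linarith
  have hsqrt (r : ℕ × ℕ) : √(ladder r) ≤ t ^ (2 * (r.1 + r.2)) := by
    rw [Real.sqrt_le_left (by positivity), ← pow_mul]
    refine (ladder_le_pow r).trans_eq ?_
    rw [← ht4, ← pow_mul]
    congr 1
    ring
  refine ⟨t, 2 * ‖T‖ ^ 2 + 1, ht0, ht1, by positivity, fun p q => ?_⟩
  calc ‖gram X W ε hε p q‖ ≤ 2 * ‖T‖ ^ 2 * (√(ladder p) * √(ladder q)) :=
        norm_gram_le_sqrt hX W ε hε p q
    _ ≤ (2 * ‖T‖ ^ 2 + 1) * (t ^ (2 * (p.1 + p.2)) * t ^ (2 * (q.1 + q.2))) := by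
        gcongr
        · linarith
        · exact hsqrt p
        · exact hsqrt q
    _ ≤ (2 * ‖T‖ ^ 2 + 1) * (t ^ ladderDist p q * t ^ (q.1 + q.2)) := by
        rw [← pow_add, ← pow_add]
        refine mul_le_mul_of_nonneg_left (pow_le_pow_of_le_one ht0.le ht1.le ?_) (by positivity)
        have := ladderDist_le p q
        omega
    _ = _ := by ring

/-! ### Geometric sequences -/

theorem exists_pow_le_div_pow {t : ℝ} (ht0 : 0 < t) (ht1 : t < 1) (m : ℕ) :
    ∃ K : ℝ, 0 < K ∧ ∀ n : ℕ, t ^ n ≤ K / (1 + (n : ℝ)) ^ m := by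
  obtain ⟨K, hK⟩ := (tendsto_pow_const_mul_const_pow_of_abs_lt_one m
    (by rwa [abs_of_pos ht0] : |t| < 1)).bddAbove_range
  have hb (n : ℕ) : (n : ℝ) ^ m * t ^ n ≤ K := hK ⟨n, rfl⟩
  have hK0 : 0 < K := by
    have h := hb 1
    simp only [Nat.cast_one, one_pow, one_mul, pow_one] at h
    linarith
  refine ⟨K / t, by positivity, fun n => ?_⟩
  have h := hb (n + 1)
  rw [le_div_iff₀ (by positivity), le_div_iff₀ ht0]
  push_cast at h
  calc t ^ n * (1 + (n : ℝ)) ^ m * t = ((n : ℝ) + 1) ^ m * t ^ (n + 1) := by ring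
    _ ≤ K := h

theorem summable_pow_add {t : ℝ} (ht0 : 0 < t) (ht1 : t < 1) :
    Summable fun q : ℕ × ℕ => t ^ (q.1 + q.2) := by
  have h := summable_geometric_of_lt_one ht0.le ht1
  simpa only [pow_add] using
    h.mul_of_nonneg h (fun _ => by positivity) (fun _ => by positivity)

end BeurlingNyman

theorem theorem6p1 (X : Set ℝ) (hX : X = Set.Ioi 0 ∨ X = Set.Ioc 0 1)
    (W ε : ℝ) (hW : 0 < W) (hε : 0 < ε) :
    (∀ m : ℕ, 1 ≤ m → ∃ C : ℝ, 0 < C ∧ ∀ p q : ℕ × ℕ, p ≠ q →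
      ‖gram X W ε hε p q‖ ≤
        C / (1 + min (Real.log 2) (Real.log 3) * (ladderDist p q : ℝ)) ^ m) ∧
    (∀ p : ℕ × ℕ, Summable fun q : {q : ℕ × ℕ // q ≠ p} => ‖gram X W ε hε p q‖) ∧
    (∀ m : ℕ, 2 < m → ∃ K : ℝ, 0 < K ∧ ∀ (p : ℕ × ℕ) (B : ℕ), 1 ≤ B →
      (Summable fun q : {q : ℕ × ℕ // B ≤ ladderDist p q} => ‖gram X W ε hε p q‖) ∧
      ∑' q : {q : ℕ × ℕ // B ≤ ladderDist p q}, ‖gram X W ε hε p q‖ ≤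
        K / (1 + (B : ℝ)) ^ (m - 2)) := by
  have hX0 : X ⊆ Set.Ioi 0 := by
    rcases hX with rfl | rfl
    exacts [subset_rfl, Set.Ioc_subset_Ioi_self]
  obtain ⟨t, M, ht0, ht1, hM, hgram⟩ := exists_norm_gram_le hX0 W ε hε
  have hsum := summable_pow_add ht0 ht1
  have hrow (p : ℕ × ℕ) : Summable fun q : ℕ × ℕ => ‖gram X W ε hε p q‖ := by
    refine Summable.of_nonneg_of_le (fun _ => norm_nonneg _) (fun q => ?_) (hsum.mul_left M)
    refine (hgram p q).trans (mul_le_mul_of_nonneg_right ?_ (by positivity))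
    exact mul_le_of_le_one_right hM.le (pow_le_one₀ ht0.le ht1.le)
  refine ⟨fun m _ => ?_, fun p => (hrow p).subtype _, fun m _ => ?_⟩
  · obtain ⟨K, hK, hpow⟩ := exists_pow_le_div_pow ht0 ht1 m
    refine ⟨M * K, by positivity, fun p q _ => ?_⟩
    have hc0 : 0 ≤ min (Real.log 2) (Real.log 3) :=
      le_min (Real.log_nonneg (by norm_num)) (Real.log_nonneg (by norm_num))
    -- `c ≤ log 2 ≤ 1`, so that powers of `1 + d` may replace those of `1 + c d`.
    have hc1 : min (Real.log 2) (Real.log 3) ≤ 1 := by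
      refine (min_le_left _ _).trans ?_
      have := Real.log_le_sub_one_of_pos (show (0 : ℝ) < 2 by norm_num)
      linarith
    calc ‖gram X W ε hε p q‖ ≤ M * t ^ ladderDist p q * t ^ (q.1 + q.2) := hgram p q
      _ ≤ M * t ^ ladderDist p q :=
          mul_le_of_le_one_right (by positivity) (pow_le_one₀ ht0.le ht1.le)
      _ ≤ M * (K / (1 + (ladderDist p q : ℝ)) ^ m) := by gcongr; exact hpow _
      _ = M * K / (1 + (ladderDist p q : ℝ)) ^ m := by ring
      _ ≤ _ := by
          gcongr
          exact mul_le_of_le_one_left (by positivity) hc1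
  · obtain ⟨K, hK, hpow⟩ := exists_pow_le_div_pow ht0 ht1 (m - 2)
    set S := ∑' q : ℕ × ℕ, t ^ (q.1 + q.2)
    have hS : 0 < S := hsum.tsum_pos (fun _ => by positivity) (0, 0) (by positivity)
    refine ⟨M * K * S, by positivity, fun p B _ => ⟨(hrow p).subtype _, ?_⟩⟩
    have hsub : Summable fun q : {q : ℕ × ℕ // B ≤ ladderDist p q} =>
        M * t ^ B * t ^ (q.1.1 + q.1.2) := (hsum.subtype _).mul_left _
    calc ∑' q : {q : ℕ × ℕ // B ≤ ladderDist p q}, ‖gram X W ε hε p q‖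
        ≤ ∑' q : {q : ℕ × ℕ // B ≤ ladderDist p q}, M * t ^ B * t ^ (q.1.1 + q.1.2) := by
          refine ((hrow p).subtype _).tsum_le_tsum (fun q => ?_) hsub
          refine (hgram p q).trans (mul_le_mul_of_nonneg_right ?_ (by positivity))
          exact mul_le_mul_of_nonneg_left (pow_le_pow_of_le_one ht0.le ht1.le q.2) hM.le
      _ = M * t ^ B * ∑' q : {q : ℕ × ℕ // B ≤ ladderDist p q}, t ^ (q.1.1 + q.1.2) :=
          tsum_mul_left
      _ ≤ M * (K / (1 + (B : ℝ)) ^ (m - 2)) * S := by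
          gcongr
          · exact hpow B
          · exact hsum.tsum_subtype_le _ {q | B ≤ ladderDist p q} fun _ => by positivity
      _ = M * K * S / (1 + (B : ℝ)) ^ (m - 2) := by ring
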